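/- **Model.** A radio network is a finite connected undirected graph $G=(V,E)$ in which every node has at least one neighbor, with a designated node $w\in V$. Time is divided into synchronous slots and all nodes start in the same slot. In each slot each node either broadcasts a message (a finite bit string) or listens. A broadcasting node gets no feedback. A listening node hears silence if none of its neighbors broadcasts, and receives the message if exactly one neighbor broadcasts; if at least two neighbors broadcast, it hears noise when collision detection is available, and silence when it is not. A randomized algorithm is run by anonymous nodes: every node draws an independent private random seed from a probability space fixed by the algorithm, and its action in a slot is a (measurable) function of its seed, of the feedback it got in all earlier slots (hence also of the slot number), and of whether it is the designated node. Contention resolution is solved in a slot if exactly one neighbor of $w$ broadcasts in that slot. For each integer $N_\Delta\ge 1$ let $\mathcal A_{N_\Delta}$ be a randomized algorithm (it may depend on $N_\Delta$; the case of a single algorithm $\mathcal A$ that does not know $N_\Delta$ is included), and let $g:\mathbb N\to\mathbb N$. We say that $\mathcal A$ solves contention resolution in $g(N_\Delta)$ slots with probability $p=p(N_\Delta)$ if for every $N_\Delta\ge1$, every such network in which every node has at most $N_\Delta$ neighbors, and every choice of the designated node $w$, the execution of $\mathcal A_{N_\Delta}$ solves contention resolution in at least one of the first $g(N_\Delta)$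 slots with probability at least $p(N_\Delta)$. **Statement.** 1. (No collision detection.) Suppose $\mathcal A$ solves contention resolution in $g(N_\Delta)$ slots with probability $p$ when collision detection is not available. (a) If $p>0$ is a constant, then $g(N_\Delta)\in\Omega(\lg N_\Delta)$. (b) If $p(N_\Delta)\ge 1-1/N_\Delta$ for every $N_\Delta\ge 1$, then $g(N_\Delta)\in\Omega(\lg^2 N_\Delta)$. 2. (Collision detection.) Suppose $\mathcal A$ solves contention resolution in $g(N_\Delta)$ slots with probability $p$ when collision detection is available, where $p>0$ is a constant. Then $g(N_\Delta)\in\Omega(\lg\lg N_\Delta)$. Here $\lg=\log_2$, and $g\in\Omega(f)$ means that there are $c>0$ and $N_0$ with $g(N)\ge c\,f(N)$ for all $N\ge N_0$. -/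

import Mathlib

open Filter Asymptotics

universe u

namespace RadioNetwork

/-- Messages are finite bit strings of arbitrary length. -/
abbrev Message : Type := List Bool

/-- What a node experiences in one slot: it broadcasts itself (and gets no feedback from the
channel), or it listens and hears silence, noise, or a message. -/
inductive Feedback : Type
  | sent
  | silence
  | noise
  | message (m : Message)

/-- A randomized distributed algorithm for anonymous nodes. Every node holds a private random seed
of law `law`. In each slot a node chooses its action, `none` (listen) or `some m` (broadcast `m`),
from the bit saying whether it is the designated node, its seed, and the list of its feedbacks in
all earlier slots (most recent first). The length of that list is the number of the current slot,
so nodes know the global clock; a node's own earlier actions are determined by its seed and by the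
list. -/
structure Algorithm where
  Seed : Type u
  [measurableSpace : MeasurableSpace Seed]
  law : MeasureTheory.Measure Seed
  [isProbabilityMeasure : MeasureTheory.IsProbabilityMeasure law]
  act : (designated : Bool) → Seed → List Feedback → Option Message
  measurableSet_act : ∀ (designated : Bool) (h : List Feedback) (a : Option Message),
    MeasurableSet {s | act designated s h = a}

attribute [instance] Algorithm.measurableSpace Algorithm.isProbabilityMeasure

noncomputable section

open scoped Classical in
/-- The feedback of node `v` in a slot in which each node `u` performs the action `a u`. The list
holds one message for each broadcasting neighbor of `v`; `cd` says whether collision detection is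
available. -/
def feedback {V : Type} [Fintype V] (cd : Bool) (G : SimpleGraph V) (a : V → Option Message)
    (v : V) : Feedback :=
  match a v with
  | some _ => .sent
  | none =>
    match (G.neighborFinset v).toList.filterMap a with
    | [] => .silence
    | [m] => .message m
    | _ :: _ :: _ => if cd then .noise else .silence

namespace Algorithm

variable (A : Algorithm.{u}) {V : Type}

open scoped Classical in
/-- The action of node `u` given its history `h`, in the network with designated node `w`. -/
def action (w : V) (seed : V → A.Seed) (h : V → List Feedback) (u : V) : Option Message :=
  A.act (decide (u = w)) (seed u) (h u)

/-- `A.history cd G w seed t v` is the list of feedbacks of node `v` in the first `t` slots, most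
recent first. -/
def history [Fintype V] (cd : Bool) (G : SimpleGraph V) (w : V) (seed : V → A.Seed) :
    ℕ → V → List Feedback
  | 0, _ => []
  | t + 1, v =>
    feedback cd G (A.action w seed (history cd G w seed t)) v :: history cd G w seed t v

/-- In slot `t` (counted from `0`) exactly one neighbor of the designated node `w` broadcasts. -/
def IsolatesNeighbor [Fintype V] (cd : Bool) (G : SimpleGraph V) (w : V) (seed : V → A.Seed)
    (t : ℕ) : Prop :=
  ∃! u, G.Adj w u ∧ (A.action w seed (A.history cd G w seed t) u).isSome

open scoped Classical in
/-- `A` solves multi-hop contention resolution within `T` slots with probability at least `p`: in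
every connected network in which every node has at least `1` and at most `N` neighbors, for every
choice of the designated node `w`, with probability at least `p` over independent private seeds,
exactly one neighbor of `w` broadcasts in some slot among the first `T`. -/
def SolvesContentionResolution (cd : Bool) (N T : ℕ) (p : ℝ) : Prop :=
  ∀ (V : Type) [Fintype V] (G : SimpleGraph V) (w : V),
    G.Connected → (∀ u, 1 ≤ G.degree u ∧ G.degree u ≤ N) →
      p ≤ (MeasureTheory.Measure.pi fun _ : V => A.law).real
        {seed | ∃ t < T, A.IsolatesNeighbor cd G w seed t}

end Algorithm

end

end RadioNetwork

/-! Stars centered at the designated node already force the bounds. Until some leaf is isolated, the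
center can hear only silence or noise, and a leaf hears nothing but the center. So for fixed seeds
and a fixed guess of what the center hears, whether a potential leaf broadcasts in a slot does not
depend on which other leaves are present. An algorithm with `T` slots thus yields a family of `m`
sets of potential leaves, with `m = T` without collision detection and `m = 2 ^ T * T` with it, and
success on leaf set `X` requires that some member of the family meet `X` in exactly one point
(`exists_channel_of_isolatesNeighbor`).

By averaging (`le_of_solvesContentionResolution`) it suffices to find a distribution on `X` that is
bad for every family. Take density `2 ^ (-i)` with `i` uniform in `1, ..., K`. At scale `i`,
greedily collect the sets that add few new points to the union `U` of those already collected. A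
random `X` can avoid `U` and hit every remaining set at least twice; Harris' inequality bounds the
probability below by `exp (-c i)`. The sum of all `c i` is at most `12 (m + 1)` (`exists_costs`): a
point of `U` and a remaining set are each paid for along a geometric series in `i`. Convexity of
`exp` then gives `exp (-12 (m + 1) / K) ≤ 1 - p` (`exp_neg_le_one_sub`). With `K` about `lg N / 2`,
all three bounds follow. -/

namespace RadioNetwork

/-! ### Random subsets with independent elements, and Harris' inequality. -/

section RandomSubset

variable {α : Type*} [Fintype α] [DecidableEq α]

/-- The probability that a random subset, containing each `x` independently with probability `p x`,
equals `X`. -/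
noncomputable def subsetWeight (p : α → ℝ) (X : Finset α) : ℝ :=
  ∏ x, if x ∈ X then p x else 1 - p x

lemma subsetWeight_nonneg {p : α → ℝ} (h0 : ∀ x, 0 ≤ p x) (h1 : ∀ x, p x ≤ 1) (X : Finset α) :
    0 ≤ subsetWeight p X := by
  refine Finset.prod_nonneg fun x _ => ?_
  split_ifs
  · exact h0 x
  · linarith [h1 x]

lemma sum_prod_ite_mem (f g : α → ℝ) :
    ∑ X : Finset α, ∏ x, (if x ∈ X then f x else g x) = ∏ x, (f x + g x) := by
  rw [Finset.prod_add, Finset.powerset_univ]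
  refine Finset.sum_congr rfl fun X _ => ?_
  rw [Finset.prod_ite]
  congr 1
  · exact Finset.prod_congr (by ext; simp) fun _ _ => rfl
  · exact Finset.prod_congr (by ext; simp) fun _ _ => rfl

lemma sum_subsetWeight (p : α → ℝ) : ∑ X, subsetWeight p X = 1 := by
  simp [subsetWeight, sum_prod_ite_mem]

lemma sum_subsetWeight_disjoint (p : α → ℝ) (S : Finset α) :
    ∑ X, subsetWeight p X * (if Disjoint X S then 1 else 0) = ∏ x ∈ S, (1 - p x) := by
  have h : ∀ X : Finset α, subsetWeight p X * (if Disjoint X S then 1 else 0) =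
      ∏ x, (if x ∈ X then (if x ∈ S then 0 else p x) else 1 - p x) := by
    intro X
    split_ifs with hd
    · rw [mul_one]
      refine Finset.prod_congr rfl fun x _ => ?_
      by_cases hx : x ∈ X
      · simp [hx, Finset.disjoint_left.1 hd hx]
      · simp [hx]
    · rw [mul_zero]
      obtain ⟨x, hx, hS⟩ := Finset.not_disjoint_iff.1 hd
      exact (Finset.prod_eq_zero (Finset.mem_univ x) (by simp [hx, hS])).symm
  simp_rw [h]
  rw [sum_prod_ite_mem, ← Finset.prod_subset (Finset.subset_univ S)]
  · exact Finset.prod_congr rfl fun x hx => by simp [hx]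
  · intro x _ hx
    simp [hx]

lemma sum_subsetWeight_meets (p : α → ℝ) (S : Finset α) :
    ∑ X, subsetWeight p X * (if ¬ Disjoint X S then 1 else 0) = 1 - ∏ x ∈ S, (1 - p x) := by
  rw [← sum_subsetWeight_disjoint, eq_sub_iff_add_eq, ← Finset.sum_add_distrib]
  refine (Finset.sum_congr rfl fun X _ => ?_).trans (sum_subsetWeight p)
  split_ifs <;> simp

/-- Product weights are log-modular, which is the hypothesis of the FKG inequality. -/
lemma subsetWeight_mul (p : α → ℝ) (X Y : Finset α) :
    subsetWeight p X * subsetWeight p Y = subsetWeight p (X ⊓ Y) * subsetWeight p (X ⊔ Y) := by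
  simp only [subsetWeight, ← Finset.prod_mul_distrib]
  refine Finset.prod_congr rfl fun x _ => ?_
  by_cases hX : x ∈ X <;> by_cases hY : x ∈ Y <;> simp [hX, hY, mul_comm]

/-- Harris' inequality for finitely many increasing functions of a random subset. -/
lemma prod_sum_le_sum_prod {κ : Type*} [DecidableEq κ] {p : α → ℝ} (h0 : ∀ x, 0 ≤ p x)
    (h1 : ∀ x, p x ≤ 1) (s : Finset κ) (f : κ → Finset α → ℝ) (hf : ∀ k, 0 ≤ f k)
    (hm : ∀ k, Monotone (f k)) :
    ∏ k ∈ s, ∑ X, subsetWeight p X * f k X ≤ ∑ X, subsetWeight p X * ∏ k ∈ s, f k X := by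
  induction s using Finset.induction_on with
  | empty => simp [sum_subsetWeight]
  | insert k s hk ih =>
    rw [Finset.prod_insert hk]
    have hmul := fkg (μ := subsetWeight p) (f := f k) (g := fun X => ∏ k ∈ s, f k X)
      (fun X => subsetWeight_nonneg h0 h1 X) (hf k)
      (fun X => Finset.prod_nonneg fun k _ => hf k X) (hm k)
      (fun X Y hXY => Finset.prod_le_prod (fun k _ => hf k X) fun k _ => hm k hXY)
      (fun X Y => (subsetWeight_mul p X Y).le)
    rw [sum_subsetWeight, one_mul] at hmul
    refine (mul_le_mul_of_nonneg_left ih ?_).trans (hmul.trans_eq ?_)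
    · exact Finset.sum_nonneg fun X _ => mul_nonneg (subsetWeight_nonneg h0 h1 X) (hf k X)
    · exact Finset.sum_congr rfl fun X _ => by rw [Finset.prod_insert hk]

lemma prod_meets_le {κ : Type*} [DecidableEq κ] {p : α → ℝ} (h0 : ∀ x, 0 ≤ p x)
    (h1 : ∀ x, p x ≤ 1) (s : Finset κ) (S : κ → Finset α) :
    ∏ k ∈ s, (1 - ∏ x ∈ S k, (1 - p x)) ≤
      ∑ X with ∀ k ∈ s, ¬ Disjoint X (S k), subsetWeight p X := by
  simp_rw [← sum_subsetWeight_meets]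
  refine (prod_sum_le_sum_prod h0 h1 s (fun k X => if ¬ Disjoint X (S k) then 1 else 0)
    ?_ ?_).trans_eq ?_
  · intro k X
    dsimp only
    split_ifs <;> simp
  · intro k X Y hXY
    dsimp only
    by_cases hY : Disjoint Y (S k)
    · simp [hY, Disjoint.mono_left hXY hY]
    · rw [if_pos hY]
      split_ifs <;> simp
  · rw [Finset.sum_filter]
    refine Finset.sum_congr rfl fun X _ => ?_
    rw [Finset.prod_ite_zero]
    simp

/-- Density zero on `U` is the law conditioned on avoiding `U`, an event of probability `(1 - r) ^
U.card`. -/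
lemma subsetWeight_zero_on_mul_le {r : ℝ} (h0 : 0 ≤ r) (h1 : r ≤ 1) (U X : Finset α) :
    (1 - r) ^ U.card * subsetWeight (fun x => if x ∈ U then 0 else r) X ≤
      subsetWeight (fun _ => r) X := by
  have hU : (1 - r) ^ U.card = ∏ x, (if x ∈ U then 1 - r else 1) := by
    rw [Finset.prod_ite_mem, Finset.univ_inter, Finset.prod_const]
  rw [hU, subsetWeight, ← Finset.prod_mul_distrib]
  refine Finset.prod_le_prod (fun x _ => ?_) fun x _ => ?_
  · have := sub_nonneg.2 h1
    split_ifs <;> simp_all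
  · split_ifs <;> simp_all

lemma subsetWeight_zero_on_eq_zero {r : ℝ} {U X : Finset α} (h : ¬ Disjoint X U) :
    subsetWeight (fun x => if x ∈ U then 0 else r) X = 0 := by
  obtain ⟨x, hx, hU⟩ := Finset.not_disjoint_iff.1 h
  exact Finset.prod_eq_zero (Finset.mem_univ x) (by simp [hx, hU])

end RandomSubset

/-! ### Exponential estimates and the greedy chain of collected sets. -/

lemma exp_neg_two_mul_le {r : ℝ} (h0 : 0 ≤ r) (h1 : r ≤ 1 / 2) : Real.exp (-(2 * r)) ≤ 1 - r := by
  have h := Real.add_one_le_exp (2 * r)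
  rw [Real.exp_neg, inv_le_comm₀ (Real.exp_pos _) (by linarith)]
  refine le_trans ?_ h
  rw [inv_le_iff_one_le_mul₀ (by linarith)]
  nlinarith

/-- With `x = r * h`, both `exp (-x) ≤ 1 / (1 + x)` and `exp (-1/x) ≤ 1 / (1 + 1/x)` hold, and the
two right-hand sides sum to `1`. -/
lemma exp_neg_inv_le {r : ℝ} {h : ℕ} (h0 : 0 < r) (h1 : r ≤ 1) (hh : 0 < h) :
    Real.exp (-(r * h)⁻¹) ≤ 1 - (1 - r) ^ h := by
  set x : ℝ := r * h with hx
  have hx0 : 0 < x := by positivity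
  have hpow : (1 - r) ^ h ≤ (1 + x)⁻¹ := by
    calc (1 - r) ^ h ≤ Real.exp (-r) ^ h :=
          pow_le_pow_left₀ (by linarith) (by linarith [Real.add_one_le_exp (-r)]) h
      _ = (Real.exp x)⁻¹ := by rw [← Real.exp_nat_mul, ← Real.exp_neg, hx]; ring_nf
      _ ≤ (1 + x)⁻¹ := by
          gcongr
          linarith [Real.add_one_le_exp x]
  have hexp : Real.exp (-x⁻¹) ≤ (1 + x⁻¹)⁻¹ := by
    rw [Real.exp_neg]
    gcongr
    linarith [Real.add_one_le_exp x⁻¹]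
  have hid : (1 + x⁻¹)⁻¹ = 1 - (1 + x)⁻¹ := by
    field_simp
    ring
  linarith

section Chain

variable {α ι : Type*} [DecidableEq α] [Fintype ι] [DecidableEq ι]

/-- Each index joining `A` may enlarge the union by at most `θ`. A largest `B` within this budget
admits no further index. -/
lemma exists_superset_forall_lt_card_sdiff (F : ι → Finset α) (A : Finset ι) (θ : ℕ) :
    ∃ B, A ⊆ B ∧ (B.biUnion F).card + θ * A.card ≤ (A.biUnion F).card + θ * B.card ∧
      ∀ j ∉ B, θ < (F j \ B.biUnion F).card := by
  obtain ⟨B, hB, hmax⟩ := Finset.exists_max_image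
    (Finset.univ.filter fun B : Finset ι => A ⊆ B ∧
      (B.biUnion F).card + θ * A.card ≤ (A.biUnion F).card + θ * B.card) Finset.card
    ⟨A, by simp⟩
  simp only [Finset.mem_filter, Finset.mem_univ, true_and] at hB hmax
  refine ⟨B, hB.1, hB.2, fun j hj => ?_⟩
  by_contra! hle
  have h := hmax (insert j B) ⟨hB.1.trans (Finset.subset_insert _ _), ?_⟩
  · rw [Finset.card_insert_of_notMem hj] at h
    omega
  · rw [Finset.card_insert_of_notMem hj, Finset.biUnion_insert]
    have : (F j ∪ B.biUnion F).card = (F j \ B.biUnion F).card + (B.biUnion F).card := by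
      rw [Finset.card_sdiff_add_card]
    rw [this, mul_add]
    linarith [hB.2]

lemma exists_chain (F : ι → Finset α) :
    ∃ A : ℕ → Finset ι, A 0 = ∅ ∧ Monotone A ∧
      (∀ i, ((A (i + 1)).biUnion F).card + 2 * 2 ^ (i + 1) * (A i).card ≤
        ((A i).biUnion F).card + 2 * 2 ^ (i + 1) * (A (i + 1)).card) ∧
      ∀ i, ∀ j ∉ A (i + 1), 2 * 2 ^ (i + 1) < (F j \ (A (i + 1)).biUnion F).card := by
  choose next hsub hcard hlt using exists_superset_forall_lt_card_sdiff F
  exact ⟨fun n => Nat.rec ∅ (fun i A => next A (2 * 2 ^ (i + 1))) n, rfl,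
    monotone_nat_of_le_succ fun i => hsub _ _, fun i => hcard _ _, fun i => hlt _ _⟩

end Chain

lemma exists_disjoint_halves {α : Type*} [DecidableEq α] (D : Finset α) :
    ∃ S : Bool → Finset α, (∀ b, S b ⊆ D) ∧ Disjoint (S true) (S false) ∧
      ∀ b, (S b).card = D.card / 2 := by
  obtain ⟨S, hS, hc⟩ := Finset.exists_subset_card_eq (s := D) (n := D.card / 2) (by omega)
  obtain ⟨S', hS', hc'⟩ := Finset.exists_subset_card_eq (s := D \ S) (n := D.card / 2)
    (by rw [Finset.card_sdiff_of_subset hS]; omega)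
  refine ⟨fun b => if b then S else S', ?_, ?_, ?_⟩
  · rintro (_ | _)
    · simpa using hS'.trans Finset.sdiff_subset
    · simpa using hS
  · simpa using (Finset.disjoint_of_subset_left hS' Finset.sdiff_disjoint).symm
  · rintro (_ | _) <;> simp [hc, hc']

/-- The factor `2` in the exponent pays for the two halves `S j true` and `S j false`, each of which
has to be hit. -/
lemma exp_neg_sum_inv_le {α ι : Type*} [DecidableEq α] {r : ℝ} (h0 : 0 < r) (h1 : r ≤ 1)
    (U : Finset α) (s : Finset ι)
    (S : ι → Bool → Finset α) (n : ι → ℕ) (hn : ∀ j ∈ s, 0 < n j)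
    (hcard : ∀ j b, (S j b).card = n j) (hdisj : ∀ j b, Disjoint (S j b) U) :
    Real.exp (-∑ j ∈ s, 2 * (r * (n j : ℝ))⁻¹) ≤
      ∏ k ∈ s ×ˢ (Finset.univ : Finset Bool),
        (1 - ∏ x ∈ S k.1 k.2, (1 - (if x ∈ U then 0 else r))) := by
  have hprod : ∀ j b, ∏ x ∈ S j b, (1 - (if x ∈ U then 0 else r)) = (1 - r) ^ n j := by
    intro j b
    rw [← hcard j b, ← Finset.prod_const]
    refine Finset.prod_congr rfl fun x hx => ?_
    rw [if_neg (Finset.disjoint_left.1 (hdisj j b) hx)]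
  simp_rw [hprod]
  rw [← Finset.sum_neg_distrib, Real.exp_sum, Finset.prod_product]
  refine Finset.prod_le_prod (fun j _ => (Real.exp_pos _).le) fun j hj => ?_
  have hb := exp_neg_inv_le h0 h1 (hn j hj)
  rw [Fintype.prod_bool]
  calc Real.exp (-(2 * (r * (n j : ℝ))⁻¹))
      = Real.exp (-(r * (n j : ℝ))⁻¹) * Real.exp (-(r * (n j : ℝ))⁻¹) := by
        rw [← Real.exp_add]
        ring_nf
    _ ≤ _ := mul_le_mul hb hb (Real.exp_pos _).le ((Real.exp_pos _).le.trans hb)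

/-! ### Failure probabilities across the scales `2 ^ (-i)`. -/

section Costs

variable {α ι : Type*} [Fintype α] [DecidableEq α] [Fintype ι] [DecidableEq ι]

/-- Hitting two disjoint parts of `F j` gives at least two common points, and avoiding the union
over `A` gives none, so no intersection is a singleton. -/
lemma pow_mul_sum_meets_le (F : ι → Finset α) (A : Finset ι) {r : ℝ} (h0 : 0 ≤ r) (h1 : r ≤ 1)
    (S : ι → Bool → Finset α) (hsub : ∀ j b, S j b ⊆ F j \ A.biUnion F)
    (hdisj : ∀ j, Disjoint (S j true) (S j false)) :
    (1 - r) ^ (A.biUnion F).card *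
        ∑ X with ∀ k ∈ Aᶜ ×ˢ (Finset.univ : Finset Bool), ¬ Disjoint X (S k.1 k.2),
          subsetWeight (fun x => if x ∈ A.biUnion F then 0 else r) X ≤
      ∑ X with (∀ j, (X ∩ F j).card ≠ 1) ∧ ∀ j ∉ A, (X ∩ F j).Nonempty,
        subsetWeight (fun _ => r) X := by
  rw [Finset.mul_sum, Finset.sum_filter, Finset.sum_filter]
  refine Finset.sum_le_sum fun X _ => ?_
  have hw := subsetWeight_nonneg (p := fun _ : α => r) (fun _ => h0)
    (fun _ => h1) X
  by_cases hX : ∀ k ∈ Aᶜ ×ˢ (Finset.univ : Finset Bool), ¬ Disjoint X (S k.1 k.2)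
  · rw [if_pos hX]
    by_cases hd : Disjoint X (A.biUnion F)
    · have hmeet : ∀ j ∉ A, 1 < (X ∩ F j).card := by
        intro j hj
        obtain ⟨x, hx, hxS⟩ := Finset.not_disjoint_iff.1
          (hX (j, true) (by simp [hj]))
        obtain ⟨y, hy, hyS⟩ := Finset.not_disjoint_iff.1
          (hX (j, false) (by simp [hj]))
        refine Finset.one_lt_card.2 ⟨x, ?_, y, ?_, ?_⟩
        · exact Finset.mem_inter.2 ⟨hx, (Finset.mem_sdiff.1 (hsub j _ hxS)).1⟩
        · exact Finset.mem_inter.2 ⟨hy, (Finset.mem_sdiff.1 (hsub j _ hyS)).1⟩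
        · rintro rfl
          exact Finset.disjoint_left.1 (hdisj j) hxS hyS
      rw [if_pos]
      · exact subsetWeight_zero_on_mul_le h0 h1 _ X
      · refine ⟨fun j => ?_, fun j hj => ?_⟩
        · by_cases hj : j ∈ A
          · have : X ∩ F j = ∅ := Finset.disjoint_iff_inter_eq_empty.1
              (Finset.disjoint_of_subset_right (Finset.subset_biUnion_of_mem F hj) hd)
            simp [this]
          · exact (hmeet j hj).ne'
        · exact Finset.card_pos.1 (by have := hmeet j hj; omega)
    · rw [subsetWeight_zero_on_eq_zero hd, mul_zero]
      split_ifs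
      · exact hw
      · rfl
  · rw [if_neg hX]
    split_ifs
    · exact hw
    · rfl

/-- A random subset of density `r` can avoid `A.biUnion F` and meet every other `F j` in at least
two elements. -/
lemma exp_neg_cost_le (F : ι → Finset α) (A : Finset ι) {r : ℝ} (h0 : 0 < r) (h1 : r ≤ 1 / 2)
    (hA : ∀ j ∉ A, 2 ≤ (F j \ A.biUnion F).card) :
    Real.exp (-(2 * r * (A.biUnion F).card +
        ∑ j ∈ Aᶜ, 2 * (r * ((F j \ A.biUnion F).card / 2 : ℕ))⁻¹)) ≤
      ∑ X with (∀ j, (X ∩ F j).card ≠ 1) ∧ ∀ j ∉ A, (X ∩ F j).Nonempty,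
        subsetWeight (fun _ => r) X := by
  choose S hsub hdisj hcard using fun j => exists_disjoint_halves (F j \ A.biUnion F)
  have hlow : Real.exp (-(2 * r * (A.biUnion F).card)) ≤ (1 - r) ^ (A.biUnion F).card := by
    calc Real.exp (-(2 * r * (A.biUnion F).card))
        = Real.exp (-(2 * r)) ^ (A.biUnion F).card := by
          rw [← Real.exp_nat_mul]
          ring_nf
      _ ≤ (1 - r) ^ (A.biUnion F).card :=
          pow_le_pow_left₀ (Real.exp_pos _).le (exp_neg_two_mul_le h0.le h1) _
  have hhigh := exp_neg_sum_inv_le h0 (by linarith) (A.biUnion F) Aᶜ S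
    (fun j => (F j \ A.biUnion F).card / 2)
    (fun j hj => by have := hA j (Finset.mem_compl.1 hj); omega) hcard
    (fun j b => Finset.disjoint_of_subset_left (hsub j b) Finset.sdiff_disjoint)
  have hmeets := prod_meets_le (p := fun x => if x ∈ A.biUnion F then 0 else r)
    (fun x => by split_ifs <;> linarith) (fun x => by split_ifs <;> linarith)
    (Aᶜ ×ˢ (Finset.univ : Finset Bool)) (fun k => S k.1 k.2)
  rw [neg_add, Real.exp_add]
  have hlast := pow_mul_sum_meets_le F A h0.le (by linarith) S hsub hdisj
  have hpow : 0 ≤ (1 - r) ^ (A.biUnion F).card := pow_nonneg (by linarith) _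
  have hexp := Real.exp_pos (-∑ j ∈ Aᶜ, 2 * (r * ((F j \ A.biUnion F).card / 2 : ℕ))⁻¹)
  have hmul := mul_le_mul hlow (hhigh.trans hmeets) hexp.le hpow
  refine hmul.trans (le_of_eq_of_le ?_ hlast)
  congr!

/-- Points entering at scale `i` number at most `2 * 2 ^ i` per new index and are charged `2 ^
(-i)`, halving at every later scale, hence `4` per index. The boundary term makes the induction
telescope. -/
lemma sum_half_pow_mul_le {u a : ℕ → ℕ} (hu : u 0 = 0)
    (h : ∀ i, u (i + 1) + 2 * 2 ^ (i + 1) * a i ≤ u i + 2 * 2 ^ (i + 1) * a (i + 1)) (n : ℕ) :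
    ∑ i ∈ Finset.Icc 1 n, (1 / 2 : ℝ) ^ i * u i + (1 / 2 : ℝ) ^ n * u n ≤ 4 * a n := by
  induction n with
  | zero => simp [hu]
  | succ n ih =>
    rw [Finset.sum_Icc_succ_top (by omega)]
    have hn : (u (n + 1) : ℝ) + 2 * 2 ^ (n + 1) * a n ≤ u n + 2 * 2 ^ (n + 1) * a (n + 1) := by
      exact_mod_cast h n
    have hpos : (0 : ℝ) < (1 / 2) ^ n := by positivity
    have hmul := mul_le_mul_of_nonneg_left hn hpos.le
    have h2 : ∀ y : ℝ, (1 / 2 : ℝ) ^ n * (2 * 2 ^ (n + 1) * y) = 4 * y := by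
      intro y
      have : (1 / 2 : ℝ) ^ n * 2 ^ n = 1 := by rw [← mul_pow]; norm_num
      linear_combination (4 * y) * this
    rw [mul_add, mul_add, h2, h2] at hmul
    have h3 : (1 / 2 : ℝ) ^ (n + 1) = (1 / 2) ^ n / 2 := by ring
    rw [h3]
    nlinarith

/-- While `P` holds the terms at least double, because `s` decreases. So the sum is at most twice
the last nonzero term, which the threshold on `s` keeps at most `1`. -/
lemma sum_inv_le_of_antitone {s : ℕ → ℕ} (hs : Antitone s) {P : ℕ → Prop} [DecidablePred P]
    (hP : ∀ i, P (i + 1) → P i) (hlt : ∀ i, P (i + 1) → 2 * 2 ^ (i + 1) < s (i + 1)) (n : ℕ) :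
    ∑ i ∈ Finset.Icc 1 n, (if P i then ((1 / 2 : ℝ) ^ i * (s i / 2 : ℕ))⁻¹ else 0) ≤ 2 := by
  have key : ∀ n, P (n + 1) →
      ∑ i ∈ Finset.Icc 1 (n + 1), (if P i then ((1 / 2 : ℝ) ^ i * (s i / 2 : ℕ))⁻¹ else 0) ≤
        2 * ((1 / 2 : ℝ) ^ (n + 1) * (s (n + 1) / 2 : ℕ))⁻¹ := by
    intro n
    induction n with
    | zero =>
      intro h
      simp only [zero_add, Finset.Icc_self, Finset.sum_singleton] at h ⊢
      rw [if_pos h]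
      have : (0 : ℝ) ≤ ((1 / 2 : ℝ) ^ 1 * (s 1 / 2 : ℕ))⁻¹ := by positivity
      linarith
    | succ n ih =>
      intro h
      rw [Finset.sum_Icc_succ_top (by omega), if_pos h]
      have h1 := ih (hP _ h)
      have hs2 : 0 < s (n + 1 + 1) / 2 := by
        have := hlt _ h
        have : 0 < 2 ^ (n + 1 + 1) := by positivity
        omega
      have hle : s (n + 1 + 1) / 2 ≤ s (n + 1) / 2 := Nat.div_le_div_right (hs (by omega))
      have h2 : ((1 / 2 : ℝ) ^ (n + 1) * (s (n + 1) / 2 : ℕ))⁻¹ ≤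
          ((1 / 2 : ℝ) ^ (n + 1) * (s (n + 1 + 1) / 2 : ℕ))⁻¹ := by
        gcongr
      have h3 : ((1 / 2 : ℝ) ^ (n + 1 + 1) * (s (n + 1 + 1) / 2 : ℕ))⁻¹ =
          2 * ((1 / 2 : ℝ) ^ (n + 1) * (s (n + 1 + 1) / 2 : ℕ))⁻¹ := by
        rw [pow_succ _ (n + 1)]
        field_simp
      rw [h3] at *
      linarith
  induction n with
  | zero => simp
  | succ n ih =>
    by_cases h : P (n + 1)
    · refine (key n h).trans ?_
      have hs2 : 2 ^ (n + 1) ≤ s (n + 1) / 2 := by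
        have := hlt _ h
        omega
      have : (1 : ℝ) ≤ (1 / 2 : ℝ) ^ (n + 1) * (s (n + 1) / 2 : ℕ) := by
        calc (1 : ℝ) = (1 / 2 : ℝ) ^ (n + 1) * 2 ^ (n + 1) := by rw [← mul_pow]; norm_num
          _ ≤ _ := by gcongr; exact_mod_cast hs2
      linarith [inv_le_one_of_one_le₀ this]
    · rw [Finset.sum_Icc_succ_top (by omega), if_neg h, add_zero]
      exact ih

/-- For every family of `m` sets, the failure probabilities of random subsets of density
`2 ^ (-i)`, `1 ≤ i ≤ K`, are at least `exp (- c i)` with `∑ c i ≤ 12 (m + 1)`. -/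
theorem exists_costs (F : ι → Finset α) {K : ℕ}
    (hK : 2 * 2 ^ K * (Fintype.card ι + 1) < Fintype.card α) :
    ∃ c : ℕ → ℝ, (∑ i ∈ Finset.Icc 1 K, c i ≤ 12 * (Fintype.card ι + 1)) ∧
      ∀ i ∈ Finset.Icc 1 K, Real.exp (-c i) ≤
        ∑ X with X.Nonempty ∧ ∀ j, (X ∩ F j).card ≠ 1,
          subsetWeight (fun _ : α => (1 / 2 : ℝ) ^ i) X := by
  -- The whole space joins the family as an extra set. As long as it is never collected, `X` must
  -- hit it, which makes `X` nonempty, as a star network requires.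
  set F' : Option ι → Finset α := fun j => j.elim Finset.univ F with hF'
  obtain ⟨A, hA0, hmono, hcard, hlt⟩ := exists_chain F'
  set U : ℕ → Finset α := fun i => (A i).biUnion F' with hU
  have hUmono : Monotone U := fun i j hij =>
    Finset.biUnion_subset_biUnion_of_subset_left _ (hmono hij)
  have hUcard : ∀ i, (U i).card ≤ 2 * 2 ^ i * (A i).card := by
    intro i
    induction i with
    | zero => simp [hU, hA0]
    | succ i ih =>
      have h1 := hcard i
      have h2 : (U i).card ≤ 2 * 2 ^ (i + 1) * (A i).card := ih.trans (by gcongr <;> omega)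
      simp only [hU] at h2 ⊢
      omega
  -- Collecting the whole space would make the union everything, too large for the budget by `hK`.
  have hnone : ∀ i ≤ K, none ∉ A i := by
    intro i hi hmem
    have h1 : U i = Finset.univ := by
      refine Finset.eq_univ_of_forall fun x => Finset.mem_biUnion.2 ⟨none, hmem, ?_⟩
      simp [hF']
    have h2 := hUcard i
    rw [h1, Finset.card_univ] at h2
    have h3 : (A i).card ≤ Fintype.card ι + 1 := (Finset.card_le_univ _).trans_eq (by simp)
    have h4 : 2 * 2 ^ i * (A i).card ≤ 2 * 2 ^ K * (Fintype.card ι + 1) := by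
      gcongr
      omega
    omega
  refine ⟨fun i => 2 * (1 / 2 : ℝ) ^ i * (U i).card +
    ∑ j ∈ (A i)ᶜ, 2 * ((1 / 2 : ℝ) ^ i * ((F' j \ U i).card / 2 : ℕ))⁻¹, ?_, ?_⟩
  · rw [Finset.sum_add_distrib]
    have hlow : ∑ i ∈ Finset.Icc 1 K, 2 * (1 / 2 : ℝ) ^ i * (U i).card ≤
        8 * (Fintype.card ι + 1) := by
      have h := sum_half_pow_mul_le (u := fun i => (U i).card) (a := fun i => (A i).card)
        (by simp [hU, hA0]) hcard K
      have hAK : ((A K).card : ℝ) ≤ Fintype.card ι + 1 := by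
        exact_mod_cast (Finset.card_le_univ (A K)).trans_eq (by simp)
      have hpos : 0 ≤ (1 / 2 : ℝ) ^ K * (U K).card := by positivity
      simp_rw [mul_assoc, ← Finset.mul_sum]
      linarith
    have hhigh : ∑ i ∈ Finset.Icc 1 K, ∑ j ∈ (A i)ᶜ,
        2 * ((1 / 2 : ℝ) ^ i * ((F' j \ U i).card / 2 : ℕ))⁻¹ ≤ 4 * (Fintype.card ι + 1) := by
      have hrw : ∀ i, ∑ j ∈ (A i)ᶜ, 2 * ((1 / 2 : ℝ) ^ i * ((F' j \ U i).card / 2 : ℕ))⁻¹ =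
          ∑ j, 2 * (if j ∉ A i then ((1 / 2 : ℝ) ^ i * ((F' j \ U i).card / 2 : ℕ))⁻¹ else 0) := by
        intro i
        simp_rw [mul_ite, mul_zero]
        rw [← Finset.sum_filter]
        exact Finset.sum_congr (by ext; simp) fun _ _ => rfl
      simp_rw [hrw]
      rw [Finset.sum_comm]
      simp_rw [← Finset.mul_sum]
      calc 2 * ∑ j, ∑ i ∈ Finset.Icc 1 K,
            (if j ∉ A i then ((1 / 2 : ℝ) ^ i * ((F' j \ U i).card / 2 : ℕ))⁻¹ else 0)
          ≤ 2 * ∑ _j : Option ι, 2 := by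
            gcongr with j
            exact sum_inv_le_of_antitone (s := fun i => (F' j \ U i).card)
              (fun i k hik => Finset.card_le_card (Finset.sdiff_subset_sdiff le_rfl (hUmono hik)))
              (fun i h hm => h (hmono (Nat.le_succ i) hm)) (fun i h => hlt i j h) K
        _ = 4 * (Fintype.card ι + 1) := by
            simp
            ring
    linarith
  · intro i hi
    obtain ⟨hi1, hiK⟩ := Finset.mem_Icc.1 hi
    obtain ⟨i, rfl⟩ : ∃ k, i = k + 1 := ⟨i - 1, by omega⟩
    have hr : (1 / 2 : ℝ) ^ (i + 1) ≤ 1 / 2 := by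
      rw [pow_succ]
      have : (1 / 2 : ℝ) ^ i ≤ 1 := pow_le_one₀ (by norm_num) (by norm_num)
      linarith
    refine (exp_neg_cost_le F' (A (i + 1)) (r := (1 / 2 : ℝ) ^ (i + 1)) (by positivity) hr
      fun j hj => ?_).trans ?_
    · have := hlt i j hj
      have : 0 < 2 ^ (i + 1) := by positivity
      omega
    · refine Finset.sum_le_sum_of_subset_of_nonneg ?_ fun X _ _ =>
        subsetWeight_nonneg (fun _ => by positivity) (fun _ => by linarith) X
      intro X hX
      simp only [Finset.mem_filter, Finset.mem_univ, true_and] at hX ⊢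
      refine ⟨?_, fun j => hX.1 (some j)⟩
      simpa [hF'] using hX.2 none (hnone _ hiK)

end Costs

/-! ### Executions on stars and their simulation. -/

instance : Countable Feedback := by
  let f : Feedback → Fin 3 ⊕ Message
    | .sent => .inl 0
    | .silence => .inl 1
    | .noise => .inl 2
    | .message m => .inr m
  refine Function.Injective.countable (f := f) fun a b h => ?_
  cases a <;> cases b <;> simp_all [f]

instance : MeasurableSpace (List Feedback) := ⊤
instance : MeasurableSpace (Option Message) := ⊤
instance : DiscreteMeasurableSpace (List Feedback) := ⟨fun _ => trivial⟩
instance : DiscreteMeasurableSpace (Option Message) := ⟨fun _ => trivial⟩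

/-- The feedback of a leaf of a star, from its own action and that of the center. -/
def leafFeedback : Option Message → Option Message → Feedback
  | some _, _ => .sent
  | none, none => .silence
  | none, some m => .message m

namespace Algorithm

variable (A : Algorithm.{u})

/-- The history of a center with seed `s` that, whenever it listens in slot `t`, hears noise if
`c t` and silence otherwise. -/
def centerHistory (c : ℕ → Bool) (s : A.Seed) : ℕ → List Feedback
  | 0 => []
  | t + 1 =>
    (if (A.act true s (centerHistory c s t)).isSome then .sent
      else if c t then .noise else .silence) :: centerHistory c s t

/-- The history of a leaf with seed `s`, attached to a center with seed `s₀` as in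
`centerHistory`. -/
def leafHistory (c : ℕ → Bool) (s₀ s : A.Seed) : ℕ → List Feedback
  | 0 => []
  | t + 1 =>
    leafFeedback (A.act false s (leafHistory c s₀ s t))
      (A.act true s₀ (A.centerHistory c s₀ t)) :: leafHistory c s₀ s t

/-- The leaf of `leafHistory` broadcasts in slot `t`. -/
def LeafBroadcasts (c : ℕ → Bool) (s₀ s : A.Seed) (t : ℕ) : Prop :=
  (A.act false s (A.leafHistory c s₀ s t)).isSome

end Algorithm

/-- Unless exactly one leaf broadcasts, one bit describes what a listening center hears. -/
lemma match_filterMap_eq {ι : Type} (cd : Bool) (a : Option ι → Option Message)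
    (ha : ¬ ∃! i, (a (some i)).isSome) (b : Bool)
    (hb : b = true ↔ cd = true ∧ ∃ i, (a (some i)).isSome) (l : List (Option ι))
    (hmem : ∀ u, u ∈ l ↔ u ≠ none) :
    (match l.filterMap a with
      | [] => Feedback.silence
      | [m] => .message m
      | _ :: _ :: _ => if cd then .noise else .silence) =
      if b then .noise else .silence := by
  split
  · next h =>
    rw [List.filterMap_eq_nil_iff] at h
    have : b = false := by
      by_contra hbt
      obtain ⟨i, hi⟩ := (hb.1 (by simpa using hbt)).2
      rw [h _ ((hmem (some i)).2 (by simp))] at hi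
      simp at hi
    simp [this]
  · next m h =>
    exfalso
    apply ha
    obtain ⟨l₁, u, l₂, rfl, h1, hu, h2⟩ := List.filterMap_eq_cons_iff.1 h
    rw [List.filterMap_eq_nil_iff] at h2
    obtain ⟨i, rfl⟩ := Option.ne_none_iff_exists'.1 ((hmem u).1 (by simp))
    refine ⟨i, by simp [hu], fun j hj => ?_⟩
    have hjm := (hmem (some j)).2 (by simp)
    simp only [List.mem_append, List.mem_cons] at hjm
    rcases hjm with hj' | hj' | hj'
    · simp [h1 _ hj'] at hj
    · simpa using hj'
    · simp [h2 _ hj'] at hj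
  · next m m' l' h =>
    have hmm : m ∈ l.filterMap a := by simp [h]
    obtain ⟨u, hu, hum⟩ := List.mem_filterMap.1 hmm
    obtain ⟨i, rfl⟩ := Option.ne_none_iff_exists'.1 ((hmem u).1 hu)
    have : b = cd := by
      rw [Bool.eq_iff_iff, hb]
      exact ⟨fun h => h.1, fun h => ⟨h, i, by simp [hum]⟩⟩
    rw [this]

section Star

variable {ι : Type} [Fintype ι]

lemma feedback_star_leaf (cd : Bool) (a : Option ι → Option Message) (i : ι) :
    feedback cd (SimpleGraph.starGraph none) a (some i) = leafFeedback (a (some i)) (a none) := by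
  classical
  have h : ∀ inst : Fintype ((SimpleGraph.starGraph (none : Option ι)).neighborSet (some i)),
      @SimpleGraph.neighborFinset _ (SimpleGraph.starGraph (none : Option ι)) (some i) inst =
        {none} := by
    intro _
    ext u
    simp only [SimpleGraph.mem_neighborFinset, SimpleGraph.starGraph_adj, Finset.mem_singleton]
    cases u <;> simp
  unfold feedback
  rw [h, Finset.toList_singleton]
  cases a (some i) <;> cases h0 : a none <;> simp [leafFeedback, h0]

lemma feedback_star_center (cd : Bool) (a : Option ι → Option Message)
    (ha : ¬ ∃! i, (a (some i)).isSome) (b : Bool)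
    (hb : b = true ↔ cd = true ∧ ∃ i, (a (some i)).isSome) :
    feedback cd (SimpleGraph.starGraph none) a none =
      if (a none).isSome then .sent else if b then .noise else .silence := by
  classical
  unfold feedback
  cases hn : a none with
  | some m => simp
  | none =>
    simp only [Option.isSome_none, Bool.false_eq_true, if_false]
    refine match_filterMap_eq cd a ha b hb _ fun u => ?_
    simp only [Finset.mem_toList, SimpleGraph.mem_neighborFinset, SimpleGraph.starGraph_adj]
    simp [eq_comm]

lemma degree_star_none
    (inst : Fintype ((SimpleGraph.starGraph (none : Option ι)).neighborSet none)) :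
    @SimpleGraph.degree _ (SimpleGraph.starGraph (none : Option ι)) none inst = Fintype.card ι := by
  classical
  have h := SimpleGraph.degree_starGraph_center (r := (none : Option ι))
  rw [Fintype.card_option, Nat.add_sub_cancel] at h
  rw [← h]
  congr!

lemma degree_star_some (i : ι)
    (inst : Fintype ((SimpleGraph.starGraph (none : Option ι)).neighborSet (some i))) :
    @SimpleGraph.degree _ (SimpleGraph.starGraph (none : Option ι)) (some i) inst = 1 := by
  classical
  rw [← SimpleGraph.degree_starGraph_of_ne_center (r := (none : Option ι)) (v := some i) (by simp)]
  congr!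

lemma isolatesNeighbor_star (A : Algorithm.{u}) (cd : Bool) (seed : Option ι → A.Seed) (t : ℕ) :
    A.IsolatesNeighbor cd (SimpleGraph.starGraph none) none seed t ↔
      ∃! i : ι, (A.act false (seed (some i))
        (A.history cd (SimpleGraph.starGraph none) none seed t (some i))).isSome := by
  classical
  unfold Algorithm.IsolatesNeighbor Algorithm.action
  constructor
  · rintro ⟨u, ⟨hadj, hu⟩, huniq⟩
    cases u with
    | none => simp at hadj
    | some i =>
      refine ⟨i, by simpa using hu, fun j hj => ?_⟩
      have := huniq (some j) ⟨by simp, by simpa using hj⟩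
      simpa using this
  · rintro ⟨i, hi, huniq⟩
    refine ⟨some i, ⟨by simp, by simpa using hi⟩, ?_⟩
    rintro (_ | j) ⟨hadj, hj⟩
    · simp at hadj
    · rw [huniq j (by simpa using hj)]

/-- If an execution on a star isolates a leaf, then so does the simulation for some sequence of
what the center hears. -/
lemma exists_channel_of_isolatesNeighbor (A : Algorithm.{u}) (cd : Bool)
    (seed : Option ι → A.Seed) {T : ℕ}
    (h : ∃ t < T, A.IsolatesNeighbor cd (SimpleGraph.starGraph none) none seed t) :
    ∃ c : ℕ → Bool, (∀ t, c t = true → cd = true ∧ t < T) ∧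
      ∃ t < T, ∃! i, A.LeafBroadcasts c (seed none) (seed (some i)) t := by
  classical
  set H := A.history cd (SimpleGraph.starGraph none) none seed with hH
  -- The guess is read off the real execution, and cut off at `T` so that only finitely many guesses
  -- are possible.
  let c : ℕ → Bool := fun t =>
    decide (t < T ∧ cd = true ∧ ∃ i, (A.action none seed (H t) (some i)).isSome)
  refine ⟨c, fun t ht => ?_, ?_⟩
  · have := of_decide_eq_true ht
    exact ⟨this.2.1, this.1⟩
  by_contra! hno
  -- If the simulation never isolates a leaf, the center never receives a message, so simulated and
  -- real histories agree through slot `T`.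
  have key : ∀ t ≤ T, H t none = A.centerHistory c (seed none) t ∧
      ∀ i, H t (some i) = A.leafHistory c (seed none) (seed (some i)) t := by
    intro t
    induction t with
    | zero => exact fun _ => ⟨rfl, fun _ => rfl⟩
    | succ t ih =>
      intro ht
      obtain ⟨h1, h2⟩ := ih (by omega)
      have hact0 : A.action none seed (H t) none =
          A.act true (seed none) (A.centerHistory c (seed none) t) := by
        simp [Algorithm.action, h1]
      have hact : ∀ i, A.action none seed (H t) (some i) =
          A.act false (seed (some i)) (A.leafHistory c (seed none) (seed (some i)) t) := by
        intro i
        simp [Algorithm.action, h2]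
      constructor
      · change feedback cd _ (A.action none seed (H t)) none :: H t none = _
        rw [feedback_star_center cd _ _ (c t), hact0, h1]
        · rfl
        · have htT : t < T := by omega
          simp [c, htT]
        · simp_rw [hact]
          exact hno t (by omega)
      · intro i
        change feedback cd _ (A.action none seed (H t)) (some i) :: H t (some i) = _
        rw [feedback_star_leaf, hact0, hact, h2]
        rfl
  obtain ⟨t, ht, hiso⟩ := h
  rw [isolatesNeighbor_star] at hiso
  refine hno t ht ?_
  simp_rw [← hH, (key t ht.le).2] at hiso
  exact hiso

end Star

/-! ### Measurability of the simulation, and restriction of product measures. -/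

section Measurability

open MeasureTheory

variable (A : Algorithm.{u})

lemma measurable_act (d : Bool) :
    Measurable fun q : A.Seed × List Feedback => A.act d q.1 q.2 := by
  refine measurable_from_prod_countable_left fun h => ?_
  exact measurable_to_countable' fun a => A.measurableSet_act d h a

lemma measurable_centerHistory (c : ℕ → Bool) (t : ℕ) :
    Measurable fun s => A.centerHistory c s t := by
  induction t with
  | zero => exact measurable_const
  | succ t ih =>
    have hg : Measurable fun q : Option Message × List Feedback =>
        (if q.1.isSome then Feedback.sent else if c t then .noise else .silence) :: q.2 :=
      Measurable.of_discrete
    exact hg.comp (((measurable_act A true).comp (measurable_id.prodMk ih)).prodMk ih)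

lemma measurable_leafHistory (c : ℕ → Bool) (t : ℕ) :
    Measurable fun q : A.Seed × A.Seed => A.leafHistory c q.1 q.2 t := by
  induction t with
  | zero => exact measurable_const
  | succ t ih =>
    have hg : Measurable fun q : (Option Message × Option Message) × List Feedback =>
        leafFeedback q.1.1 q.1.2 :: q.2 := Measurable.of_discrete
    have h1 := (measurable_act A false).comp
      ((measurable_snd (α := A.Seed) (β := A.Seed)).prodMk ih)
    have hfst : Measurable fun q : A.Seed × A.Seed => q.1 := measurable_fst
    have h2 := (measurable_act A true).comp
      (hfst.prodMk ((measurable_centerHistory A c t).comp hfst))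
    exact hg.comp ((h1.prodMk h2).prodMk ih)

lemma measurable_leafBroadcasts (c : ℕ → Bool) (t : ℕ) :
    Measurable fun q : A.Seed × A.Seed => A.LeafBroadcasts c q.1 q.2 t := by
  have hg : Measurable fun a : Option Message => (a.isSome = true : Prop) := Measurable.of_discrete
  exact hg.comp ((measurable_act A false).comp
    (measurable_snd.prodMk (measurable_leafHistory A c t)))

/-- Restricting the coordinates of a product probability measure along an injection. -/
lemma map_pi_comp_injective {V W S : Type*} [Fintype V] [Fintype W] [MeasurableSpace S]
    (μ : Measure S) [IsProbabilityMeasure μ] {e : V → W} (he : Function.Injective e) :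
    MeasurePreserving (fun (x : W → S) v => x (e v)) (Measure.pi fun _ => μ)
      (Measure.pi fun _ => μ) := by
  classical
  have hmeas : Measurable fun (x : W → S) v => x (e v) := by fun_prop
  refine ⟨hmeas, (Measure.pi_eq fun s hs => ?_).symm⟩
  rw [Measure.map_apply hmeas (.univ_pi hs)]
  have hpre : (fun (x : W → S) v => x (e v)) ⁻¹' Set.univ.pi s =
      Set.univ.pi fun w => ⋂ v, ⋂ (_ : e v = w), s v := by
    ext x
    simp only [Set.mem_preimage, Set.mem_univ_pi, Set.mem_iInter]
    exact ⟨fun h w v hv => hv ▸ h v, fun h v => h (e v) v rfl⟩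
  rw [hpre, Measure.pi_pi, ← Finset.prod_subset (Finset.subset_univ (Finset.univ.image e)),
    Finset.prod_image he.injOn]
  · refine Finset.prod_congr rfl fun v _ => ?_
    congr 1
    ext x
    simp only [Set.mem_iInter]
    exact ⟨fun h => h v rfl, fun h v' hv' => he hv' ▸ h⟩
  · intro w _ hw
    have : (⋂ v, ⋂ (_ : e v = w), s v) = Set.univ := by
      simp only [Set.iInter_eq_univ]
      exact fun v hv => absurd (Finset.mem_image.2 ⟨v, Finset.mem_univ v, hv⟩) hw
    rw [this, measure_univ]

end Measurability

/-! ### From a randomized algorithm to a family of sets. -/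

section Averaging

open MeasureTheory

variable (A : Algorithm.{u}) {cd : Bool} {N T : ℕ} {p : ℝ} {κ : Type} [Fintype κ]

open scoped Classical in
/-- The set of leaves that broadcast in slot `j.2` if the center hears `dec j.1`. -/
noncomputable def broadcastFamily (dec : κ → ℕ → Bool) (ω : Option (Fin N) → A.Seed)
    (j : κ × Fin T) : Finset (Fin N) :=
  Finset.univ.filter fun i => A.LeafBroadcasts (dec j.1) (ω none) (ω (some i)) j.2

lemma measurableSet_exists_unique_leafBroadcasts {ι : Type} [Countable ι] (dec : κ → ℕ → Bool) :
    MeasurableSet {ω : Option ι → A.Seed | ∃ j : κ × Fin T,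
      ∃! i, A.LeafBroadcasts (dec j.1) (ω none) (ω (some i)) j.2} := by
  have h : ∀ (j : κ × Fin T) (i : ι), Measurable fun ω : Option ι → A.Seed =>
      A.LeafBroadcasts (dec j.1) (ω none) (ω (some i)) j.2 := by
    intro j i
    have hω : Measurable fun ω : Option ι → A.Seed => (ω none, ω (some i)) :=
      (measurable_pi_apply none).prodMk (measurable_pi_apply (some i))
    exact (measurable_leafBroadcasts A (dec j.1) j.2).comp hω
  refine measurableSet_setOfPred.2 (Measurable.exists fun j => Measurable.exists fun i => ?_)
  exact (h j i).and (Measurable.forall fun i' => (h j i').imp measurable_const)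

/-- Seeds are drawn once for all `N` potential leaves; restricting them to `X` has the law of the
seeds on the star with leaf set `X`. Thus all `X` share one probability space and one random family.
The union over all guesses can only enlarge the success event. -/
lemma le_measureReal_hit (hA : A.SolvesContentionResolution cd N T p) (dec : κ → ℕ → Bool)
    (hdec : ∀ c : ℕ → Bool, (∀ t, c t = true → cd = true ∧ t < T) → ∃ k, dec k = c)
    {X : Finset (Fin N)} (hX : X.Nonempty) :
    MeasurableSet {ω | ∃ j : κ × Fin T, (X ∩ broadcastFamily A dec ω j).card = 1} ∧
    p ≤ (Measure.pi fun _ : Option (Fin N) => A.law).real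
      {ω | ∃ j : κ × Fin T, (X ∩ broadcastFamily A dec ω j).card = 1} := by
  classical
  set E : Set (Option X → A.Seed) := {ω | ∃ j : κ × Fin T,
      ∃! i, A.LeafBroadcasts (dec j.1) (ω none) (ω (some i)) j.2} with hE
  have hEm : MeasurableSet E := measurableSet_exists_unique_leafBroadcasts A dec
  have hpres := map_pi_comp_injective A.law
    (Option.map_injective (Subtype.val_injective (p := fun i => i ∈ X)))
  have hpre : {ω | ∃ j : κ × Fin T, (X ∩ broadcastFamily A dec ω j).card = 1} =
      (fun (ω : Option (Fin N) → A.Seed) (v : Option X) => ω (Option.map Subtype.val v)) ⁻¹' E := by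
    ext ω
    simp only [Set.mem_ofPred_eq, hE, Set.mem_preimage]
    refine exists_congr fun j => ?_
    rw [Finset.card_eq_one]
    constructor
    · rintro ⟨i, hi⟩
      have hi' := Finset.ext_iff.1 hi
      simp only [broadcastFamily, Finset.mem_inter, Finset.mem_filter, Finset.mem_univ, true_and,
        Finset.mem_singleton] at hi'
      exact ⟨⟨i, ((hi' i).2 rfl).1⟩, ((hi' i).2 rfl).2,
        fun i' hb => Subtype.ext ((hi' i').1 ⟨i'.2, hb⟩)⟩
    · rintro ⟨i, hb, huniq⟩
      refine ⟨i, Finset.ext fun i' => ?_⟩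
      simp only [broadcastFamily, Finset.mem_inter, Finset.mem_filter, Finset.mem_univ, true_and,
        Finset.mem_singleton]
      constructor
      · rintro ⟨hi', hb'⟩
        exact congrArg Subtype.val (huniq ⟨i', hi'⟩ hb')
      · rintro rfl
        exact ⟨i.2, hb⟩
  have hstar := hA (Option X) (SimpleGraph.starGraph none) none
    (SimpleGraph.connected_starGraph none) fun u => by
      have hc := hX.card_pos
      have hN : X.card ≤ N := (Finset.card_le_univ X).trans_eq (by simp)
      cases u with
      | none => rw [degree_star_none, Fintype.card_coe]; exact ⟨hc, hN⟩
      | some i => rw [degree_star_some]; exact ⟨le_rfl, hc.trans_le hN⟩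
  rw [hpre]
  refine ⟨hpres.measurable hEm, ?_⟩
  rw [measureReal_def, hpres.measure_preimage hEm.nullMeasurableSet, ← measureReal_def]
  refine hstar.trans (measureReal_mono fun seed hs => ?_)
  obtain ⟨c, hc, t, ht, h⟩ := exists_channel_of_isolatesNeighbor A cd seed hs
  obtain ⟨k, rfl⟩ := hdec c hc
  exact ⟨(k, ⟨t, ht⟩), h⟩

/-- Yao's principle for stars with random leaf sets. -/
theorem le_of_solvesContentionResolution (hN : 1 ≤ N)
    (hA : A.SolvesContentionResolution cd N T p) (dec : κ → ℕ → Bool)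
    (hdec : ∀ c : ℕ → Bool, (∀ t, c t = true → cd = true ∧ t < T) → ∃ k, dec k = c)
    (W : Finset (Fin N) → ℝ) (hW : ∀ X, 0 ≤ W X) (L : ℝ)
    (hL : ∀ F : κ × Fin T → Finset (Fin N),
      L ≤ ∑ X with X.Nonempty ∧ ∀ j, (X ∩ F j).card ≠ 1, W X) :
    L ≤ (1 - p) * ∑ X, W X := by
  classical
  set μ := Measure.pi fun _ : Option (Fin N) => A.law with hμ
  set D : Finset (Fin N) → Set (Option (Fin N) → A.Seed) := fun X =>
    {ω | ∃ j : κ × Fin T, (X ∩ broadcastFamily A dec ω j).card = 1}ᶜ with hD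
  have hDm : ∀ X, X.Nonempty → MeasurableSet (D X) := fun X hX =>
    (le_measureReal_hit A hA dec hdec hX).1.compl
  have hDμ : ∀ X, X.Nonempty → μ.real (D X) ≤ 1 - p := by
    intro X hX
    obtain ⟨hm, hp⟩ := le_measureReal_hit A hA dec hdec hX
    rw [hD, probReal_compl_eq_one_sub hm]
    linarith
  have hp1 : 0 ≤ 1 - p := measureReal_nonneg.trans (hDμ {⟨0, hN⟩} (Finset.singleton_nonempty _))
  have hint : ∀ X ∈ Finset.univ.filter fun X : Finset (Fin N) => X.Nonempty,
      Integrable (fun ω => W X * (D X).indicator (fun _ => (1 : ℝ)) ω) μ := fun X hX =>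
    ((integrable_const (1 : ℝ)).indicator (hDm X (Finset.mem_filter.1 hX).2)).const_mul _
  calc L = ∫ _, L ∂μ := by simp
    _ ≤ ∫ ω, ∑ X with X.Nonempty, W X * (D X).indicator (fun _ => (1 : ℝ)) ω ∂μ := by
        refine integral_mono (integrable_const _) (integrable_finsetSum _ hint) fun ω => ?_
        refine (hL (broadcastFamily A dec ω)).trans_eq ?_
        rw [Finset.sum_filter, Finset.sum_filter]
        refine Finset.sum_congr rfl fun X _ => ?_
        by_cases hX : X.Nonempty <;> simp [hX, hD, Set.indicator_apply]
    _ = ∑ X with X.Nonempty, W X * μ.real (D X) := by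
        rw [integral_finsetSum _ hint]
        refine Finset.sum_congr rfl fun X hX => ?_
        rw [integral_const_mul, integral_indicator_const _ (hDm X (Finset.mem_filter.1 hX).2)]
        simp
    _ ≤ ∑ X with X.Nonempty, W X * (1 - p) :=
        Finset.sum_le_sum fun X hX =>
          mul_le_mul_of_nonneg_left (hDμ X (Finset.mem_filter.1 hX).2) (hW X)
    _ ≤ ∑ X, W X * (1 - p) :=
        Finset.sum_le_sum_of_subset_of_nonneg (Finset.filter_subset _ _)
          fun X _ _ => mul_nonneg (hW X) hp1
    _ = (1 - p) * ∑ X, W X := by rw [← Finset.sum_mul, mul_comm]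

end Averaging

/-! ### Bounds on the number of slots. -/

section SlotBounds

variable (A : Algorithm.{u}) {cd : Bool} {N T K : ℕ} {p : ℝ} {κ : Type} [Fintype κ]

/-- Jensen's inequality, through the tangent line of `exp` at `-a`. -/
lemma card_mul_exp_le_sum_exp {s : Finset ℕ} {c : ℕ → ℝ} {a : ℝ} (h : ∑ i ∈ s, c i ≤ s.card * a) :
    s.card * Real.exp (-a) ≤ ∑ i ∈ s, Real.exp (-c i) := by
  have h1 : ∀ i ∈ s, Real.exp (-a) * (1 + a - c i) ≤ Real.exp (-c i) := by
    intro i _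
    calc Real.exp (-a) * (1 + a - c i) ≤ Real.exp (-a) * Real.exp (a - c i) := by
          gcongr
          linarith [Real.add_one_le_exp (a - c i)]
      _ = Real.exp (-c i) := by
          rw [← Real.exp_add]
          ring_nf
  refine le_trans ?_ (Finset.sum_le_sum h1)
  rw [← Finset.mul_sum, Finset.sum_sub_distrib, Finset.sum_const, nsmul_eq_mul, mul_comm]
  refine mul_le_mul_of_nonneg_left ?_ (Real.exp_pos _).le
  linarith

lemma exp_neg_le_one_sub (hN : 1 ≤ N) (hA : A.SolvesContentionResolution cd N T p)
    (dec : κ → ℕ → Bool)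
    (hdec : ∀ c : ℕ → Bool, (∀ t, c t = true → cd = true ∧ t < T) → ∃ k, dec k = c)
    (hK : 0 < K) (hKN : 2 * 2 ^ K * (Fintype.card κ * T + 1) < N) :
    Real.exp (-(12 * (Fintype.card κ * T + 1) / K)) ≤ 1 - p := by
  classical
  have hK' : (0 : ℝ) < K := by exact_mod_cast hK
  have h1 : ∀ i : ℕ, (1 / 2 : ℝ) ^ i ≤ 1 := fun i => pow_le_one₀ (by norm_num) (by norm_num)
  have hw : ∀ (i : ℕ) (X : Finset (Fin N)), 0 ≤ subsetWeight (fun _ => (1 / 2 : ℝ) ^ i) X :=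
    fun i => subsetWeight_nonneg (fun _ => by positivity) (fun _ => h1 i)
  have h := le_of_solvesContentionResolution A hN hA dec hdec
    (fun X => ∑ i ∈ Finset.Icc 1 K, subsetWeight (fun _ => (1 / 2 : ℝ) ^ i) X)
    (fun X => Finset.sum_nonneg fun i _ => hw i X)
    (K * Real.exp (-(12 * (Fintype.card κ * T + 1) / K))) ?_
  · rw [Finset.sum_comm] at h
    simp only [sum_subsetWeight, Finset.sum_const, Nat.card_Icc, Nat.add_sub_cancel, nsmul_eq_mul,
      mul_one] at h
    rw [mul_comm] at h
    exact le_of_mul_le_mul_right h hK'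
  · intro F
    obtain ⟨c, hsum, hc⟩ := exists_costs F (K := K) (by simpa using hKN)
    have hcard : (Finset.Icc 1 K).card = K := by simp
    have hjensen := card_mul_exp_le_sum_exp (s := Finset.Icc 1 K) (c := c)
      (a := 12 * (Fintype.card κ * T + 1) / K) (by
        rw [hcard, mul_div_cancel₀ _ hK'.ne']
        simpa using hsum)
    rw [hcard] at hjensen
    rw [Finset.sum_comm]
    exact hjensen.trans (Finset.sum_le_sum hc)

lemma le_one_of_solvesContentionResolution (hN : 1 ≤ N)
    (hA : A.SolvesContentionResolution cd N T p) : p ≤ 1 := by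
  refine (hA (Option Unit) (SimpleGraph.starGraph none) none
    (SimpleGraph.connected_starGraph none) fun u => ?_).trans MeasureTheory.measureReal_le_one
  cases u with
  | none => rw [degree_star_none]; exact ⟨le_rfl, hN⟩
  | some i => rw [degree_star_some]; exact ⟨le_rfl, hN⟩

lemma two_pow_half_log_mul_self_le (hN : 1 ≤ N) :
    2 ^ (Nat.log 2 N / 2) * 2 ^ (Nat.log 2 N / 2) ≤ N := by
  rw [← pow_add]
  exact (Nat.pow_le_pow_right (by norm_num) (by omega)).trans (Nat.pow_log_le_self 2 (by omega))

lemma two_pow_half_log_le {m : ℕ} (hN : 1 ≤ N)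
    (h : N ≤ 2 * 2 ^ (Nat.log 2 N / 2) * (m + 1)) : 2 ^ (Nat.log 2 N / 2) ≤ 2 * (m + 1) := by
  have h1 := two_pow_half_log_mul_self_le hN
  have h2 : 0 < 2 ^ (Nat.log 2 N / 2) := by positivity
  refine Nat.le_of_mul_le_mul_left ?_ h2
  linarith

/-- Half the logarithm makes `2 ^ K` at most `√N`, leaving room for about `√N` sets in the family.
-/
lemma mul_half_log_le (hN : 1 ≤ N) (hA : A.SolvesContentionResolution cd N T p)
    (dec : κ → ℕ → Bool)
    (hdec : ∀ c : ℕ → Bool, (∀ t, c t = true → cd = true ∧ t < T) → ∃ k, dec k = c) :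
    p * (Nat.log 2 N / 2 : ℕ) ≤ 12 * (Fintype.card κ * T + 1) := by
  have hm : (0 : ℝ) ≤ Fintype.card κ * T := by positivity
  set K := Nat.log 2 N / 2 with hKdef
  rcases Nat.eq_zero_or_pos K with hK | hK
  · rw [hK]
    push_cast
    linarith
  have hK' : (0 : ℝ) < K := by exact_mod_cast hK
  rcases lt_or_ge (2 * 2 ^ K * (Fintype.card κ * T + 1)) N with h | h
  · have h1 := exp_neg_le_one_sub A hN hA dec hdec hK h
    have h2 := Real.add_one_le_exp (-(12 * (Fintype.card κ * T + 1 : ℝ) / K))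
    have h3 : p ≤ 12 * (Fintype.card κ * T + 1 : ℝ) / K := by linarith
    rwa [le_div_iff₀ hK'] at h3
  -- Here the family is too large for `exists_costs`, but then its size is already exponential in
  -- `K`.
  · have h1 : K ≤ 2 * (Fintype.card κ * T + 1) :=
      Nat.lt_two_pow_self.le.trans (two_pow_half_log_le hN h)
    have h2 : (K : ℝ) ≤ 2 * (Fintype.card κ * T + 1) := by exact_mod_cast h1
    have h3 := mul_le_mul_of_nonneg_right (le_one_of_solvesContentionResolution A hN hA) hK'.le
    linarith

lemma sq_le_two_mul_two_pow (k : ℕ) : k ^ 2 ≤ 2 * 2 ^ k := by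
  induction k with
  | zero => norm_num
  | succ k ih =>
    rcases Nat.lt_or_ge k 3 with h | h
    · interval_cases k <;> norm_num
    · rw [pow_succ 2 k]
      nlinarith

lemma sq_half_log_le (hN : 1 ≤ N)
    (hA : A.SolvesContentionResolution cd N T (1 - 1 / (N : ℝ)))
    (dec : κ → ℕ → Bool)
    (hdec : ∀ c : ℕ → Bool, (∀ t, c t = true → cd = true ∧ t < T) → ∃ k, dec k = c) :
    ((Nat.log 2 N / 2 : ℕ) : ℝ) ^ 2 ≤ 12 * (Fintype.card κ * T + 1) := by
  have hm : (0 : ℝ) ≤ Fintype.card κ * T := by positivity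
  have hsq := two_pow_half_log_mul_self_le hN
  set K := Nat.log 2 N / 2 with hKdef
  rcases Nat.eq_zero_or_pos K with hK | hK
  · rw [hK]
    push_cast
    linarith
  have hK' : (0 : ℝ) < K := by exact_mod_cast hK
  have hN' : (0 : ℝ) < N := by exact_mod_cast hN
  rcases lt_or_ge (2 * 2 ^ K * (Fintype.card κ * T + 1)) N with h | h
  · have h1 := exp_neg_le_one_sub A hN hA dec hdec hK h
    rw [sub_sub_cancel, one_div, Real.exp_neg, inv_le_inv₀ (Real.exp_pos _) hN',
      ← Real.log_le_iff_le_exp hN', le_div_iff₀ hK'] at h1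
    -- `4 ^ K ≤ N` and `2 * log 2 > 1`. Failure probability `1 / N` turns the exponent bound into `K
    -- * log N ≤ 12 (m + 1)`, whence the square.
    have h2 : (K : ℝ) ≤ Real.log N := by
      have h3 : (2 : ℝ) ^ K * 2 ^ K ≤ N := by exact_mod_cast hsq
      have h4 := Real.log_le_log (by positivity) h3
      rw [← pow_add, Real.log_pow] at h4
      push_cast at h4
      nlinarith [Real.log_two_gt_d9]
    nlinarith
  · have h1 : K ^ 2 ≤ 2 * (2 * (Fintype.card κ * T + 1)) :=
      (sq_le_two_mul_two_pow K).trans (Nat.mul_le_mul_left 2 (two_pow_half_log_le hN h))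
    have h2 : (K : ℝ) ^ 2 ≤ 2 * (2 * (Fintype.card κ * T + 1)) := by exact_mod_cast h1
    linarith

lemma logb_le_half_log (hN : 1 ≤ N) : Real.logb 2 N ≤ 2 * (Nat.log 2 N / 2 : ℕ) + 2 := by
  have h : N < 2 ^ (2 * (Nat.log 2 N / 2) + 2) :=
    (Nat.lt_pow_succ_log_self (by norm_num) N).trans_le
      (Nat.pow_le_pow_right (by norm_num) (by omega))
  have h' : (N : ℝ) ≤ 2 ^ (2 * (Nat.log 2 N / 2) + 2) := by exact_mod_cast h.le
  have hN' : (0 : ℝ) < N := by exact_mod_cast hN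
  have := Real.logb_le_logb_of_le (b := 2) (by norm_num) hN' h'
  rw [Real.logb_pow, Real.logb_self_eq_one (by norm_num)] at this
  push_cast at this
  linarith

lemma eq_const_false {c : ℕ → Bool} (hc : ∀ t, c t = true → false = true ∧ t < T) :
    (fun _ => false) = c := by
  funext t
  by_contra h
  cases hct : c t with
  | false => exact h hct.symm
  | true => exact absurd (hc t hct).1 (by decide)

/-- Without collision detection. -/
lemma mul_logb_le (hN : 1 ≤ N) (hp : 0 < p) (hA : A.SolvesContentionResolution false N T p) :
    p * Real.logb 2 N ≤ 24 * T + 26 := by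
  have h := mul_half_log_le A hN hA (fun (_ : Unit) _ => false) fun c hc =>
    ⟨(), eq_const_false hc⟩
  have h1 := mul_le_mul_of_nonneg_left (logb_le_half_log hN) hp.le
  have h2 := le_one_of_solvesContentionResolution A hN hA
  simp only [Fintype.card_unit, Nat.cast_one, one_mul] at h
  linarith

/-- Without collision detection, with high probability. -/
lemma sq_logb_le (hN : 1 ≤ N)
    (hA : A.SolvesContentionResolution false N T (1 - 1 / (N : ℝ))) :
    Real.logb 2 N ^ 2 ≤ 96 * T + 104 := by
  have h := sq_half_log_le A hN hA (fun (_ : Unit) _ => false) fun c hc =>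
    ⟨(), eq_const_false hc⟩
  have h1 := logb_le_half_log hN
  have h0 : 0 ≤ Real.logb 2 N :=
    Real.logb_nonneg (by norm_num) (by exact_mod_cast hN)
  simp only [Fintype.card_unit, Nat.cast_one, one_mul] at h
  nlinarith [sq_nonneg (((Nat.log 2 N / 2 : ℕ) : ℝ) - 1)]

/-- With collision detection. -/
lemma mul_logb_le_four_pow (hN : 1 ≤ N) (hp : 0 < p)
    (hA : A.SolvesContentionResolution true N T p) :
    p * Real.logb 2 N ≤ 50 * 4 ^ T := by
  have h := mul_half_log_le A hN hA
    -- The guesses are all `2 ^ T` bit strings, extended by `false` after slot `T`; this exponential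
    -- count costs the second logarithm.
    (fun (k : Fin T → Bool) t => if ht : t < T then k ⟨t, ht⟩ else false) fun c hc => by
      refine ⟨fun t => c t, funext fun t => ?_⟩
      by_cases ht : t < T
      · simp [ht]
      · have : c t = false := by
          by_contra h
          exact ht (hc t (by simpa using h)).2
        simp [ht, this]
  have h1 := mul_le_mul_of_nonneg_left (logb_le_half_log hN) hp.le
  have h2 := le_one_of_solvesContentionResolution A hN hA
  have h3 : (Fintype.card (Fin T → Bool) * T : ℝ) ≤ 4 ^ T := by
    have : T ≤ 2 ^ T := Nat.lt_two_pow_self.le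
    have h4 : 2 ^ T * T ≤ 4 ^ T := by
      calc 2 ^ T * T ≤ 2 ^ T * 2 ^ T := Nat.mul_le_mul_left _ this
        _ = 4 ^ T := by rw [← mul_pow]; norm_num
    simp only [Fintype.card_fun, Fintype.card_bool, Fintype.card_fin]
    exact_mod_cast h4
  have h5 : (1 : ℝ) ≤ 4 ^ T := one_le_pow₀ (by norm_num)
  linarith

end SlotBounds

lemma tendsto_logb_natCast : Tendsto (fun N : ℕ => Real.logb 2 N) atTop atTop :=
  (Real.tendsto_logb_atTop (by norm_num)).comp tendsto_natCast_atTop_atTop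

end RadioNetwork

theorem mainTheorem2 :
    -- no collision detection, constant probability
    (∀ (A : ℕ → RadioNetwork.Algorithm.{u}) (g : ℕ → ℕ) (p : ℝ), 0 < p →
      (∀ N : ℕ, 1 ≤ N → (A N).SolvesContentionResolution false N (g N) p) →
      (fun N : ℕ => Real.logb 2 N) =O[atTop] (fun N : ℕ => (g N : ℝ))) ∧
    -- no collision detection, probability at least `1 - 1 / N`
    (∀ (A : ℕ → RadioNetwork.Algorithm.{u}) (g : ℕ → ℕ),
      (∀ N : ℕ, 1 ≤ N →
        (A N).SolvesContentionResolution false N (g N) (1 - 1 / (N : ℝ))) →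
      (fun N : ℕ => Real.logb 2 N ^ 2) =O[atTop] (fun N : ℕ => (g N : ℝ))) ∧
    -- collision detection, constant probability
    (∀ (A : ℕ → RadioNetwork.Algorithm.{u}) (g : ℕ → ℕ) (p : ℝ), 0 < p →
      (∀ N : ℕ, 1 ≤ N → (A N).SolvesContentionResolution true N (g N) p) →
      (fun N : ℕ => Real.logb 2 (Real.logb 2 N)) =O[atTop] (fun N : ℕ => (g N : ℝ))) := by
  have hlog := RadioNetwork.tendsto_logb_natCast
  refine ⟨fun A g p hp hA => ?_, fun A g hA => ?_, fun A g p hp hA => ?_⟩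
  -- Once `p * lg N ≥ 52`, the additive `26` is at most half the left-hand side, which doubles the
  -- coefficient `24`. The other two parts absorb their additive constants in the same way.
  · refine IsBigO.of_bound (48 / p) ?_
    filter_upwards [eventually_ge_atTop 1, hlog.eventually_ge_atTop (52 / p)] with N hN hL
    have h := RadioNetwork.mul_logb_le (A N) hN hp (hA N hN)
    have h0 : 0 ≤ Real.logb 2 N := le_trans (by positivity) hL
    rw [div_le_iff₀ hp] at hL
    rw [Real.norm_of_nonneg h0, Real.norm_of_nonneg (Nat.cast_nonneg _), div_mul_eq_mul_div,
      le_div_iff₀ hp]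
    linarith
  · refine IsBigO.of_bound 192 ?_
    filter_upwards [eventually_ge_atTop 1, hlog.eventually_ge_atTop 15] with N hN hL
    have h := RadioNetwork.sq_logb_le (A N) hN (hA N hN)
    rw [Real.norm_of_nonneg (by positivity), Real.norm_of_nonneg (Nat.cast_nonneg _)]
    nlinarith
  · refine IsBigO.of_bound 4 ?_
    have hloglog : Tendsto (fun N : ℕ => Real.logb 2 (Real.logb 2 N)) atTop atTop :=
      (Real.tendsto_logb_atTop (by norm_num)).comp hlog
    filter_upwards [eventually_ge_atTop 1, hlog.eventually_ge_atTop 1,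
      hloglog.eventually_ge_atTop (2 * Real.logb 2 (50 / p))] with N hN hL hLL
    have h := RadioNetwork.mul_logb_le_four_pow (A N) hN hp (hA N hN)
    have h0 : 0 ≤ Real.logb 2 (Real.logb 2 N) := Real.logb_nonneg (by norm_num) hL
    rw [Real.norm_of_nonneg h0, Real.norm_of_nonneg (Nat.cast_nonneg _)]
    have h1 : Real.logb 2 N ≤ 50 / p * 2 ^ (2 * g N) := by
      rw [div_mul_eq_mul_div, le_div_iff₀ hp, pow_mul]
      norm_num
      linarith
    have h2 := Real.logb_le_logb_of_le (b := 2) (by norm_num) (by linarith) h1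
    rw [Real.logb_mul (by positivity) (by positivity), Real.logb_pow,
      Real.logb_self_eq_one (by norm_num)] at h2
    push_cast at h2
    linarith
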